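/- Consider a single-queue multi-server system with $k\ge 1$ parallel servers. Jobs $n=1,2,\dots$ arrive at random times $0\le A(1)\le A(2)\le\cdots$ and wait in one first-in first-out queue without loss; each server serves one job at a time, and the system is non-idling, i.e., a job waits only while all $k$ servers are busy. The service times $L(n)$, $n\ge1$, are iid exponential with parameter $\mu>0$, and the service process is independent of the arrival process. Let $V(n)$ be the time at which job $n$ starts service, $W(n)=V(n)-A(n)$ its waiting time, $D(n)=V(n)+L(n)$ its departure time, and $T(n)=D(n)-A(n)$ its sojourn time. For $0<\theta<k\mu$ put $$\rho_Z(\theta)=\frac1\theta\ln\Bigl(\frac{k\mu}{k\mu-\theta}\Bigr).$$ Let $0<\theta<k\mu$ with $\theta\ne\mu$. (G$|$M arrivals and service.) Suppose the arrivals are $(\sigma_A,\rho_A)$-lower constrained, i.e., for all $\vartheta>0$ and all $n\ge m\ge1$, $$\mathsf E\bigl[e^{-\vartheta(A(n)-A(m))}\bigr]\le e^{-\vartheta(\rho_A(-\vartheta)(n-m)-\sigma_A(-\vartheta))}.$$ If $\rho_Z(\theta)<\rho_A(-\theta)$, then with $$\alpha=\frac{e^{\theta\sigma_A(-\theta)}}{1-e^{-\theta(\rho_A(-\theta)-\rho_Z(\theta))}}$$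 we have, for all $n\ge1$, $$\mathsf P[T(n)>\tau]\le\alpha\,\frac{\mu}{\mu-\theta}\bigl(e^{-\theta\tau}-e^{-\mu\tau}\bigr)+e^{-\mu\tau}\quad(\tau\ge0),\qquad \mathsf P[W(n)>\tau]\le\alpha e^{-\theta\tau}\quad(\tau\in\mathbb R).$$ (GI$|$M arrivals and service.) If the inter-arrival times $A(n+1)-A(n)$, $n\ge1$, are iid, and $\rho_Z(\theta)\le\rho_A(-\theta)$, where now $\rho_A(-\theta)=-\frac1\theta\ln\mathsf E\bigl[e^{-\theta(A(2)-A(1))}\bigr]$, then the same two bounds hold with $\alpha=1$. -/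

import Mathlib

open MeasureTheory ProbabilityTheory

/-- A sample path of a single-queue multi-server system with `k` parallel servers. Jobs are labelled
`0, 1, 2, …` in the order of arrival (so the `n`-th job has label `n - 1`). Job `n` arrives at time
`A n`, starts service at time `V n` on server `s n`, occupies this server for its service time `L n`,
and departs at time `V n + L n`. The queue is lossless and first-in first-out, a server works on one
job at a time, and the system is non-idling: a job can be waiting only while all servers are busy. -/
structure IsSingleQueuePath (k : ℕ) (A L V : ℕ → ℝ) (s : ℕ → Fin k) : Prop where
  /-- no job is served before its arrival -/
  arrival_le_start : ∀ n, A n ≤ V n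
  /-- jobs start service in the order of arrival -/
  fifo : ∀ m n, m ≤ n → V m ≤ V n
  /-- a server finishes a job before it starts the next one -/
  one_at_a_time : ∀ m n, m < n → s m = s n → V m + L m ≤ V n
  /-- while a job waits, every server is busy with some job -/
  non_idling : ∀ n t, A n ≤ t → t < V n → ∀ i : Fin k, ∃ m, s m = i ∧ V m ≤ t ∧ t < V m + L m

/-- A `G | M | k` single-queue multi-server system on the probability space `(Ω, P)`: arrival times
`0 ≤ A 0 ≤ A 1 ≤ …`, iid exponential service times `L n` with parameter `μ`, independent of the
arrival process, start times `V n` and server assignments `s n` that follow the non-idling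
first-in first-out single-queue discipline. -/
structure IsGMkSystem {Ω : Type*} [MeasurableSpace Ω] (P : Measure Ω) (k : ℕ) (μ : ℝ)
    (A L V : ℕ → Ω → ℝ) (s : ℕ → Ω → Fin k) : Prop where
  rate_pos : 0 < μ
  measurable_arrival : ∀ n, Measurable (A n)
  measurable_service : ∀ n, Measurable (L n)
  arrival_nonneg : ∀ᵐ ω ∂P, 0 ≤ A 0 ω
  arrival_mono : ∀ᵐ ω ∂P, Monotone (fun n => A n ω)
  service_law : ∀ n, P.map (L n) = expMeasure μ
  service_indep : iIndepFun L P
  arrival_indep_service : IndepFun (fun ω n => A n ω) (fun ω n => L n ω) P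
  path : ∀ᵐ ω ∂P, IsSingleQueuePath k (fun n => A n ω) (fun n => L n ω) (fun n => V n ω)
    (fun n => s n ω)

/-- The waiting time of job `n`. -/
def waitingTime {Ω : Type*} (A V : ℕ → Ω → ℝ) (n : ℕ) (ω : Ω) : ℝ :=
  V n ω - A n ω

/-- The sojourn time of job `n`: departure time minus arrival time. -/
def sojournTime {Ω : Type*} (A L V : ℕ → Ω → ℝ) (n : ℕ) (ω : Ω) : ℝ :=
  (V n ω + L n ω) - A n ω

/-- The arrival process is `(σ, ρ)`-lower constrained: for all `θ > 0` and all jobs `m ≤ n`,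
`E[exp(-θ (A n - A m))] ≤ exp(-θ (ρ(-θ) (n - m) - σ(-θ)))`. -/
def IsLowerConstrained {Ω : Type*} [MeasurableSpace Ω] (P : Measure Ω) (A : ℕ → Ω → ℝ)
    (σ ρ : ℝ → ℝ) : Prop :=
  ∀ θ : ℝ, 0 < θ → ∀ m n : ℕ, m ≤ n →
    mgf (fun ω => A n ω - A m ω) P (-θ) ≤
      Real.exp (-θ * (ρ (-θ) * ((n : ℝ) - (m : ℝ)) - σ (-θ)))

/-- `GI` arrivals: the inter-arrival times `A (n + 1) - A n` are iid. -/
structure HasIIDInterarrivals {Ω : Type*} [MeasurableSpace Ω] (P : Measure Ω)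
    (A : ℕ → Ω → ℝ) : Prop where
  indep : iIndepFun (fun n ω => A (n + 1) ω - A n ω) P
  identDistrib : ∀ n, IdentDistrib (fun ω => A (n + 1) ω - A n ω) (fun ω => A 1 ω - A 0 ω) P P

/-- `ρ_A(-θ) = -(1/θ) ln E[exp(-θ X)]`, with `X` the first inter-arrival time. -/
noncomputable def giArrivalRate {Ω : Type*} [MeasurableSpace Ω] (P : Measure Ω)
    (A : ℕ → Ω → ℝ) (θ : ℝ) : ℝ :=
  -(1 / θ) * Real.log (mgf (fun ω => A 1 ω - A 0 ω) P (-θ))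

/-- `ρ_Z(θ) = (1/θ) ln (k μ / (k μ - θ))`. -/
noncomputable def rhoZ (k : ℕ) (μ θ : ℝ) : ℝ :=
  1 / θ * Real.log (k * μ / (k * μ - θ))

/-!
The start times of the jobs are bounded by an explicit function `queueStart k a l` of the arrival
times `a` and the service times `l`, in which the jobs in service are identified by their labels:
job `n` starts as soon as it has arrived, the earlier jobs have started, and fewer than `k` of the
earlier jobs are in service (`lt_queueStart_iff`, `IsSingleQueuePath.start_le_queueStart`). Since
the service times are independent of the arrivals, the arrival times may be fixed first.

The probabilistic core is `startTail_succ_le`: for fixed arrival times, the start time of job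
`n + 1` is stochastically dominated by `max (a (n + 1)) (v + Z)`, where `v` is the start time of
job `n` and `Z` is an independent exponential variable with rate `k * μ`. If fewer than `k` jobs are
in service at time `v`, the next job does not have to wait beyond `max (a (n + 1)) v`. Otherwise
some set `S` of exactly `k` jobs is in service, and lowering all their service times by `x` changes
no start time as long as these jobs stay in service at time `v` (`queueStart_eq_of_in_service`).
Lowering `k` coordinates that exceed `x` multiplies the product exponential law by `exp (-k μ x)`
(`serviceLaw_shift`), so on this event the next departure comes after an independent exponential
time with rate `k * μ` (`serviceLaw_all_in_service`).

For general arrivals, iterating the domination gives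
`P (V n > t) ≤ ∑ m ≤ n, M ^ (n - m) * exp (θ * (a m - t))` with `M = exp (θ * rhoZ k μ θ)`; averaging
over the arrivals yields a geometric series whose sum is the prefactor `α`. For iid inter-arrival
times, induction on `n` shows `P (W n > τ) ≤ exp (-θ * τ)` directly, as `W (n + 1)` is dominated by
`max 0 (W n + Z - X)` with `X` the next inter-arrival time and `E (exp (θ * (Z - X))) ≤ 1`. The
sojourn time bounds follow by convolution with the law of the job's own service time, which is
independent of its waiting time.
-/

/-! ### Start times as a function of arrival and service times -/

lemma nonempty_filter_card_lt (k n : ℕ) [NeZero k] :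
    ({S : Finset (Fin n) | S.card < k} : Finset (Finset (Fin n))).Nonempty :=
  ⟨∅, by simp [NeZero.pos k]⟩

/-- The start times of the non-idling first-in first-out queue with `k` servers, as an explicit
function of the arrival times `a` and the service times `l`. Job `n` starts at the least time `t`
with `a n ≤ t` and `queueStart k a l m ≤ t` for all `m < n` such that fewer than `k` of the jobs
`m < n` depart after `t`; the infimum runs over the sets `S` of the jobs that may still be
in service. Servers do not occur: jobs in service are identified by their labels. -/
noncomputable def queueStart (k : ℕ) [NeZero k] (a l : ℕ → ℝ) (n : ℕ) : ℝ :=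
  ({S : Finset (Fin n) | S.card < k} : Finset (Finset (Fin n))).inf'
    (nonempty_filter_card_lt k n)
    fun S => Sᶜ.fold max
      (Finset.univ.fold max (a n) fun m : Fin n => queueStart k a l m)
      fun m : Fin n => queueStart k a l m + l m
termination_by n

section Path

variable {k : ℕ} [NeZero k]

/-- The defining property of `queueStart`, in the form in which it is used throughout. -/
lemma lt_queueStart_iff (a l : ℕ → ℝ) (n : ℕ) (t : ℝ) :
    t < queueStart k a l n ↔ t < a n ∨ (∃ m < n, t < queueStart k a l m) ∨
      k ≤ ((Finset.range n).filter fun m => t < queueStart k a l m + l m).card := by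
  have hcard : ((Finset.range n).filter fun m => t < queueStart k a l m + l m).card =
      (Finset.univ.filter fun m : Fin n => t < queueStart k a l m + l m).card := by
    rw [← Finset.card_map Fin.valEmbedding]
    congr 1
    ext m
    simp only [Finset.mem_filter, Finset.mem_range, Finset.mem_map, Finset.mem_univ, true_and,
      Fin.valEmbedding_apply]
    exact ⟨fun h => ⟨⟨m, h.1⟩, h.2, rfl⟩, by rintro ⟨x, hx, rfl⟩; exact ⟨x.2, hx⟩⟩
  rw [hcard, queueStart, Finset.lt_inf'_iff]
  simp only [Finset.mem_filter, Finset.mem_univ, true_and, Finset.lt_fold_max, Finset.mem_compl]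
  constructor
  · intro h
    by_cases h1 : t < a n
    · exact Or.inl h1
    by_cases h2 : ∃ m : Fin n, t < queueStart k a l m
    · obtain ⟨m, hm⟩ := h2
      exact Or.inr (Or.inl ⟨m, m.2, hm⟩)
    refine Or.inr (Or.inr ?_)
    by_contra! h3
    rcases h _ h3 with (h4 | h4) | ⟨m, h4, h5⟩
    · exact h1 h4
    · exact h2 h4
    · simp [h5] at h4
  · rintro (h | ⟨m, hm, h⟩ | h) S hS
    · exact Or.inl (Or.inl h)
    · exact Or.inl (Or.inr ⟨⟨m, hm⟩, h⟩)
    · obtain ⟨m, hm, hmS⟩ := Finset.exists_mem_notMem_of_card_lt_card (hS.trans_le h)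
      exact Or.inr ⟨m, hmS, by simpa using hm⟩

lemma queueStart_zero (a l : ℕ → ℝ) : queueStart k a l 0 = a 0 := by
  refine eq_of_forall_lt_iff fun t => ?_
  rw [lt_queueStart_iff]
  simp [NeZero.ne k]

lemma le_queueStart (a l : ℕ → ℝ) (n : ℕ) : a n ≤ queueStart k a l n := by
  by_contra! h
  exact lt_irrefl _ ((lt_queueStart_iff a l n _).2 (Or.inl h))

lemma queueStart_mono (a l : ℕ → ℝ) : Monotone (queueStart k a l) := by
  intro m n hmn
  rcases hmn.eq_or_lt with rfl | hmn
  · rfl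
  by_contra! h
  exact lt_irrefl _ ((lt_queueStart_iff a l n _).2 (Or.inr (Or.inl ⟨m, hmn, h⟩)))

/-- Fewer than `k` of the earlier jobs are still in service when job `n` starts. -/
lemma card_lt_of_queueStart_le (a l : ℕ → ℝ) (n : ℕ) {t : ℝ} (ht : queueStart k a l n ≤ t) :
    ((Finset.range n).filter fun m => t < queueStart k a l m + l m).card < k := by
  by_contra! h
  exact absurd ((lt_queueStart_iff a l n t).2 (Or.inr (Or.inr h))) ht.not_gt

/-- The start time of job `n` depends on the arrivals up to `n` and the services before `n` only,
and a translation of the arrival times translates it. -/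
lemma queueStart_eq_add {a a' l l' : ℕ → ℝ} {c : ℝ} (n : ℕ) (ha : ∀ m ≤ n, a' m = a m + c)
    (hl : ∀ m < n, l' m = l m) : queueStart k a' l' n = queueStart k a l n + c := by
  induction n using Nat.strong_induction_on with
  | _ n ih =>
    have ih' : ∀ m < n, queueStart k a' l' m = queueStart k a l m + c := fun m hm =>
      ih m hm (fun j hj => ha j (hj.trans hm.le)) (fun j hj => hl j (hj.trans hm))
    refine eq_of_forall_lt_iff fun t => ?_
    rw [← sub_lt_iff_lt_add, lt_queueStart_iff, lt_queueStart_iff, ha n le_rfl, sub_lt_iff_lt_add]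
    have hf : ((Finset.range n).filter fun m => t < queueStart k a' l' m + l' m) =
        (Finset.range n).filter fun m => t - c < queueStart k a l m + l m := by
      refine Finset.filter_congr fun m hm => ?_
      rw [Finset.mem_range] at hm
      rw [ih' m hm, hl m hm, sub_lt_iff_lt_add, add_right_comm]
    rw [hf]
    refine or_congr_right (or_congr_left (exists_congr fun m => and_congr_right fun hm => ?_))
    rw [ih' m hm, sub_lt_iff_lt_add]

lemma queueStart_congr {a l l' : ℕ → ℝ} (n : ℕ) (hl : ∀ m < n, l' m = l m) :
    queueStart k a l' n = queueStart k a l n := by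
  simpa using queueStart_eq_add (k := k) (c := 0) n (fun m _ => (add_zero (a m)).symm) hl

/-- Changing the service times of jobs that are still in service when job `n` starts, before and
after the change, has no effect on the start times up to `n`. -/
lemma queueStart_eq_of_in_service {a l l' : ℕ → ℝ} {n : ℕ} {S : Finset ℕ}
    (hoff : ∀ m, m ∉ S → l' m = l m)
    (hl : ∀ m ∈ S, queueStart k a l n < queueStart k a l m + l m)
    (hl' : ∀ m ∈ S, queueStart k a l n < queueStart k a l m + l' m) {j : ℕ} (hj : j ≤ n) :
    queueStart k a l' j = queueStart k a l j := by
  induction j using Nat.strong_induction_on with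
  | _ j ih =>
    -- up to time `queueStart k a l n`, the two systems have the same jobs in service
    have key : ∀ t ≤ queueStart k a l n,
        (t < queueStart k a l' j ↔ t < queueStart k a l j) := by
      intro t ht
      rw [lt_queueStart_iff, lt_queueStart_iff]
      have hf : ((Finset.range j).filter fun m => t < queueStart k a l' m + l' m) =
          (Finset.range j).filter fun m => t < queueStart k a l m + l m := by
        refine Finset.filter_congr fun m hm => ?_
        rw [Finset.mem_range] at hm
        rw [ih m hm (hm.le.trans hj)]
        by_cases hmS : m ∈ S
        · exact iff_of_true (ht.trans_lt (hl' m hmS)) (ht.trans_lt (hl m hmS))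
        · rw [hoff m hmS]
      rw [hf]
      refine or_congr_right (or_congr_left (exists_congr fun m => and_congr_right fun hm => ?_))
      rw [ih m hm (hm.le.trans hj)]
    have hjn : queueStart k a l j ≤ queueStart k a l n := queueStart_mono a l hj
    refine le_antisymm (not_lt.1 fun h => ?_) (not_lt.1 fun h => ?_)
    · exact lt_irrefl _ ((key _ hjn).1 h)
    · exact lt_irrefl _ ((key _ (h.le.trans hjn)).2 h)

lemma measurable_queueStart (n : ℕ) :
    Measurable fun p : (ℕ → ℝ) × (ℕ → ℝ) => queueStart k p.1 p.2 n := by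
  induction n using Nat.strong_induction_on with
  | _ n ih =>
    refine measurable_of_Ioi fun t => ?_
    have : (fun p : (ℕ → ℝ) × (ℕ → ℝ) => queueStart k p.1 p.2 n) ⁻¹' Set.Ioi t =
        {p | t < p.1 n} ∪ ((⋃ m ∈ Finset.range n, {p | t < queueStart k p.1 p.2 m}) ∪
          ⋃ T ∈ (Finset.range n).powerset.filter fun T => k ≤ T.card,
            ⋂ m ∈ T, {p | t < queueStart k p.1 p.2 m + p.2 m}) := by
      ext p
      rw [Set.mem_preimage, Set.mem_Ioi, lt_queueStart_iff]
      simp only [Set.mem_union, Set.mem_ofPred_eq,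
        Set.mem_iUnion, Set.mem_iInter, Finset.mem_range, Finset.mem_filter, Finset.mem_powerset,
        exists_prop]
      refine or_congr_right (or_congr_right ⟨fun h => ⟨_, ⟨Finset.filter_subset _ _, h⟩,
        fun m hm => (Finset.mem_filter.1 hm).2⟩, ?_⟩)
      rintro ⟨T, ⟨hT, hk⟩, h⟩
      exact hk.trans (Finset.card_le_card fun m hm => Finset.mem_filter.2 ⟨hT hm, h m hm⟩)
    rw [this]
    refine MeasurableSet.union (measurableSet_lt measurable_const (by fun_prop))
      (MeasurableSet.union (Finset.measurableSet_biUnion _ fun m hm => ?_)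
        (Finset.measurableSet_biUnion _ fun T hT => Finset.measurableSet_biInter _ fun m hm => ?_))
    · exact measurableSet_lt measurable_const (ih m (Finset.mem_range.1 hm))
    · have hmn : m < n := Finset.mem_range.1
        (Finset.mem_powerset.1 (Finset.mem_filter.1 hT).1 hm)
      exact measurableSet_lt measurable_const ((ih m hmn).add (by fun_prop))

lemma measurable_queueStart_left (a : ℕ → ℝ) (n : ℕ) :
    Measurable fun l : ℕ → ℝ => queueStart k a l n :=
  (measurable_queueStart n).comp measurable_prodMk_left

/-- In every sample path of the system, jobs start no later than `queueStart` says. -/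
lemma IsSingleQueuePath.start_le_queueStart {A L V : ℕ → ℝ} {s : ℕ → Fin k}
    (h : IsSingleQueuePath k A L V s) (n : ℕ) : V n ≤ queueStart k A L n := by
  induction n using Nat.strong_induction_on with
  | _ n ih =>
    by_contra! hlt
    set t := queueStart k A L n with ht
    choose f hf using h.non_idling n t (le_queueStart A L n) hlt
    have hcard := card_lt_of_queueStart_le A L n ht.ge
    refine absurd (Finset.card_le_card_of_injOn (s := Finset.univ) f ?_ ?_) (by
      simpa using hcard)
    · intro i _
      obtain ⟨-, h2, h3⟩ := hf i
      have hin : f i < n := by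
        by_contra! hni
        exact absurd (h.fifo n (f i) hni) (h2.trans_lt hlt).not_ge
      simp only [Finset.coe_filter, Finset.mem_range, Set.mem_ofPred_eq]
      exact ⟨hin, h3.trans_le (by gcongr; exact ih _ hin)⟩
    · intro i _ j _ hij
      rw [← (hf i).1, ← (hf j).1, hij]

end Path

/-! ### The exponential distribution -/

lemma expMeasure_Ioi {r : ℝ} (hr : 0 < r) (x : ℝ) :
    expMeasure r (Set.Ioi x) = ENNReal.ofReal (Real.exp (-(r * max x 0))) := by
  have := isProbabilityMeasure_expMeasure hr
  have hc := cdf_expMeasure_eq hr x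
  rw [cdf_eq_real] at hc
  rw [← Set.compl_Iic, ← ENNReal.ofReal_toReal (measure_ne_top _ _)]
  change ENNReal.ofReal ((expMeasure r).real _) = _
  rw [probReal_compl_eq_one_sub measurableSet_Iic, hc]
  split_ifs with h
  · rw [max_eq_left h]; ring_nf
  · rw [max_eq_right (not_le.1 h).le]; simp

lemma expMeasure_Ici {r : ℝ} (hr : 0 < r) (x : ℝ) :
    expMeasure r (Set.Ici x) = ENNReal.ofReal (Real.exp (-(r * max x 0))) := by
  rw [← expMeasure_Ioi hr]
  have hac : expMeasure r ≪ volume := withDensity_absolutelyContinuous _ _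
  refine measure_congr (hac.ae_eq ?_)
  exact Ioi_ae_eq_Ici.symm

/-- Memorylessness of the exponential distribution. -/
lemma expMeasure_shift {r x : ℝ} (hr : 0 < r) (hx : 0 ≤ x) {s : Set ℝ} (hs : MeasurableSet s) :
    expMeasure r (Set.Ioi x ∩ (fun y => y - x) ⁻¹' s) =
      ENNReal.ofReal (Real.exp (-(r * x))) * expMeasure r s := by
  have := isProbabilityMeasure_expMeasure hr
  have key : ((expMeasure r).restrict (Set.Ioi x)).map (fun y => y - x) =
      ENNReal.ofReal (Real.exp (-(r * x))) • expMeasure r := by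
    refine Measure.ext_of_Ici _ _ fun b => ?_
    rw [Measure.map_apply (by fun_prop) measurableSet_Ici,
      Measure.restrict_apply ((by fun_prop : Measurable fun y : ℝ => y - x) measurableSet_Ici),
      Measure.smul_apply, smul_eq_mul, expMeasure_Ici hr,
      ← ENNReal.ofReal_mul (Real.exp_pos _).le, ← Real.exp_add]
    rcases le_or_gt b 0 with hb | hb
    · have : (fun y => y - x) ⁻¹' Set.Ici b ∩ Set.Ioi x = Set.Ioi x := by
        ext y; simp only [Set.mem_inter_iff, Set.mem_preimage, Set.mem_Ici, Set.mem_Ioi]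
        constructor
        · exact fun h => h.2
        · exact fun h => ⟨by linarith, h⟩
      rw [this, expMeasure_Ioi hr, max_eq_left hx, max_eq_right hb]
      simp
    · have : (fun y => y - x) ⁻¹' Set.Ici b ∩ Set.Ioi x = Set.Ici (x + b) := by
        ext y; simp only [Set.mem_inter_iff, Set.mem_preimage, Set.mem_Ici, Set.mem_Ioi]
        constructor
        · exact fun h => by linarith [h.1]
        · exact fun h => ⟨by linarith, by linarith⟩
      rw [this, expMeasure_Ici hr, max_eq_left hb.le, max_eq_left (by linarith)]
      ring_nf
  have h2 := congrArg (fun ν => ν s) key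
  simp only [Measure.map_apply (by fun_prop : Measurable fun y : ℝ => y - x) hs,
    Measure.restrict_apply ((by fun_prop : Measurable fun y : ℝ => y - x) hs),
    Measure.smul_apply, smul_eq_mul] at h2
  rw [Set.inter_comm, h2]

lemma lintegral_expMeasure (r : ℝ) {f : ℝ → ENNReal} (hf : Measurable f) :
    ∫⁻ y, f y ∂expMeasure r =
      ∫⁻ y in Set.Ici 0, ENNReal.ofReal (r * Real.exp (-(r * y))) * f y := by
  have hm : Measurable (gammaPDF 1 r) := (measurable_gammaPDFReal 1 r).ennreal_ofReal
  rw [expMeasure, gammaMeasure, lintegral_withDensity_eq_lintegral_mul _ hm hf,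
    ← lintegral_indicator measurableSet_Ici]
  refine lintegral_congr fun y => ?_
  change exponentialPDF r y * f y = _
  rw [exponentialPDF_eq]
  by_cases hy : 0 ≤ y
  · simp [hy]
  · simp [hy]

lemma lintegral_exp_expMeasure {r θ : ℝ} (hr : 0 < r) (hθ : θ < r) :
    ∫⁻ y, ENNReal.ofReal (Real.exp (θ * y)) ∂expMeasure r = ENNReal.ofReal (r / (r - θ)) := by
  rw [lintegral_expMeasure r (by fun_prop), Measure.restrict_congr_set Ioi_ae_eq_Ici.symm]
  have h1 : ∀ y : ℝ, ENNReal.ofReal (r * Real.exp (-(r * y))) * ENNReal.ofReal (Real.exp (θ * y)) =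
      ENNReal.ofReal (r * Real.exp ((θ - r) * y)) := fun y => by
    rw [← ENNReal.ofReal_mul (by positivity), mul_assoc, ← Real.exp_add]; ring_nf
  simp_rw [h1]
  rw [← ofReal_integral_eq_lintegral_ofReal, integral_const_mul,
    integral_exp_mul_Ioi (sub_neg.2 hθ)]
  · congr 1
    have : r - θ ≠ 0 := by linarith
    have : θ - r ≠ 0 := by linarith
    simp only [mul_zero, Real.exp_zero]
    field_simp
    ring
  · exact (integrableOn_exp_mul_Ioi (sub_neg.2 hθ) 0).const_mul r
  · exact ae_of_all _ fun y => by positivity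

lemma setLIntegral_exp_expMeasure {r θ τ : ℝ} (hr : 0 < r) (hθ : θ ≠ r) (hτ : 0 ≤ τ) :
    ∫⁻ y in Set.Iic τ, ENNReal.ofReal (Real.exp (θ * y)) ∂expMeasure r =
      ENNReal.ofReal (r / (r - θ) * (1 - Real.exp ((θ - r) * τ))) := by
  rw [← lintegral_indicator measurableSet_Iic, lintegral_expMeasure r
    ((by fun_prop : Measurable fun y : ℝ => ENNReal.ofReal (Real.exp (θ * y))).indicator
      measurableSet_Iic)]
  have h1 : ∀ y : ℝ, ENNReal.ofReal (r * Real.exp (-(r * y))) *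
      (Set.Iic τ).indicator (fun y => ENNReal.ofReal (Real.exp (θ * y))) y =
      (Set.Iic τ).indicator (fun y => ENNReal.ofReal (r * Real.exp ((θ - r) * y))) y := fun y => by
    by_cases hy : y ≤ τ
    · simp only [Set.mem_Iic, hy, Set.indicator_of_mem]
      rw [← ENNReal.ofReal_mul (by positivity), mul_assoc, ← Real.exp_add]; ring_nf
    · simp [hy]
  simp_rw [h1]
  rw [lintegral_indicator measurableSet_Iic, Measure.restrict_restrict measurableSet_Iic,
    Set.inter_comm, Set.Ici_inter_Iic, Measure.restrict_congr_set Ioc_ae_eq_Icc.symm]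
  have hc : Continuous fun y : ℝ => r * Real.exp ((θ - r) * y) := by fun_prop
  rw [← ofReal_integral_eq_lintegral_ofReal
    ((hc.integrableOn_Icc (a := 0) (b := τ)).mono_set Set.Ioc_subset_Icc_self)
    (ae_of_all _ fun y => by positivity), ← intervalIntegral.integral_of_le hτ]
  congr 1
  have h0 : θ - r ≠ 0 := sub_ne_zero.2 hθ
  have h0' : r - θ ≠ 0 := sub_ne_zero.2 hθ.symm
  rw [intervalIntegral.integral_const_mul, intervalIntegral.integral_comp_mul_left _ h0,
    integral_exp]
  simp only [mul_zero, Real.exp_zero, smul_eq_mul]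
  field_simp
  ring

/-- The law of the sequence of service times: iid exponential with rate `r`. -/
noncomputable def serviceLaw (r : ℝ) : Measure (ℕ → ℝ) :=
  Measure.infinitePi fun _ => expMeasure r

lemma isProbabilityMeasure_serviceLaw {r : ℝ} (hr : 0 < r) :
    IsProbabilityMeasure (serviceLaw r) := by
  have := isProbabilityMeasure_expMeasure hr
  unfold serviceLaw
  infer_instance

/-- Joint memorylessness: conditioned on the coordinates in `S` exceeding `x`, the sequence
with these coordinates lowered by `x` has the original law. -/
lemma serviceLaw_shift {r x : ℝ} (hr : 0 < r) (hx : 0 ≤ x) (S : Finset ℕ) {G : Set (ℕ → ℝ)}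
    (hG : MeasurableSet G) :
    serviceLaw r ({l | ∀ m ∈ S, x < l m} ∩
        (fun l m => if m ∈ S then l m - x else l m) ⁻¹' G) =
      ENNReal.ofReal (Real.exp (-(r * x))) ^ S.card * serviceLaw r G := by
  have := isProbabilityMeasure_expMeasure hr
  have := isProbabilityMeasure_serviceLaw hr
  set c := ENNReal.ofReal (Real.exp (-(r * x))) with hc
  have hc0 : c ≠ 0 := by simp [hc, Real.exp_pos]
  have hct : c ≠ ⊤ := ENNReal.ofReal_ne_top
  have hT : Measurable fun (l : ℕ → ℝ) m => if m ∈ S then l m - x else l m := by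
    refine measurable_pi_lambda _ fun m => ?_
    split_ifs <;> fun_prop
  have hE : MeasurableSet {l : ℕ → ℝ | ∀ m ∈ S, x < l m} := by
    have : {l : ℕ → ℝ | ∀ m ∈ S, x < l m} = ⋂ m ∈ S, {l | x < l m} := by ext; simp
    rw [this]
    exact Finset.measurableSet_biInter _ fun m _ => measurableSet_lt (by fun_prop) (by fun_prop)
  have key : (c ^ S.card)⁻¹ • ((serviceLaw r).restrict {l | ∀ m ∈ S, x < l m}).map
      (fun (l : ℕ → ℝ) m => if m ∈ S then l m - x else l m) = serviceLaw r := by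
    refine Measure.eq_infinitePi _ fun T t ht => ?_
    have hTt : MeasurableSet ((T : Set ℕ).pi t) :=
      MeasurableSet.pi T.countable_toSet fun i _ => ht i
    rw [Measure.smul_apply, Measure.map_apply hT hTt, Measure.restrict_apply (hT hTt)]
    have hset : (fun (l : ℕ → ℝ) m => if m ∈ S then l m - x else l m) ⁻¹' ((T : Set ℕ).pi t) ∩
        {l : ℕ → ℝ | ∀ m ∈ S, x < l m} = ((T ∪ S : Finset ℕ) : Set ℕ).pi fun m =>
          if m ∈ S then Set.Ioi x ∩ (fun y => y - x) ⁻¹' (if m ∈ T then t m else Set.univ)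
          else t m := by
      ext l
      simp only [Set.mem_inter_iff, Set.mem_preimage, Set.mem_pi, Finset.mem_coe,
        Set.mem_ofPred_eq, Finset.mem_union]
      constructor
      · rintro ⟨h1, h2⟩ m hm
        by_cases hmS : m ∈ S
        · by_cases hmT : m ∈ T
          · simpa [hmS, hmT, h2 m hmS] using h1 m hmT
          · simpa [hmS, hmT] using h2 m hmS
        · have hmT := hm.resolve_right hmS
          simpa [hmS] using h1 m hmT
      · intro h
        refine ⟨fun m hm => ?_, fun m hm => ?_⟩
        · have := h m (Or.inl hm)
          by_cases hmS : m ∈ S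
          · simp only [hmS, hm, if_true] at this ⊢; exact this.2
          · simpa [hmS] using this
        · have := h m (Or.inr hm)
          simp only [hm, if_true] at this; exact this.1
    have hmeas : ∀ m, MeasurableSet (if m ∈ S then
        Set.Ioi x ∩ (fun y => y - x) ⁻¹' (if m ∈ T then t m else Set.univ) else t m) := by
      intro m
      split_ifs
      · exact measurableSet_Ioi.inter ((by fun_prop : Measurable fun y : ℝ => y - x) (ht m))
      · simp
      · exact ht m
    rw [hset, serviceLaw, Measure.infinitePi_pi _ fun m _ => hmeas m]
    have hterm : ∀ m ∈ T ∪ S, expMeasure r (if m ∈ S then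
        Set.Ioi x ∩ (fun y => y - x) ⁻¹' (if m ∈ T then t m else Set.univ) else t m) =
        (if m ∈ S then c else 1) * (if m ∈ T then expMeasure r (t m) else 1) := by
      intro m hm
      by_cases hmS : m ∈ S
      · simp only [hmS, if_true]
        rw [expMeasure_shift hr hx (by split_ifs; exacts [ht m, MeasurableSet.univ])]
        split_ifs <;> simp [hc]
      · have hmT : m ∈ T := by simpa [hmS] using hm
        simp [hmS, hmT]
    rw [Finset.prod_congr rfl hterm, Finset.prod_mul_distrib, Finset.prod_ite_mem,
      Finset.prod_ite_mem, Finset.union_inter_cancel_left, Finset.union_inter_cancel_right,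
      Finset.prod_const, smul_eq_mul, ← mul_assoc,
      ENNReal.inv_mul_cancel (pow_ne_zero _ hc0) (ENNReal.pow_ne_top hct), one_mul]
  have h2 := congrArg (fun ν => ν G) key
  simp only [Measure.smul_apply, Measure.map_apply hT hG, Measure.restrict_apply (hT hG),
    smul_eq_mul] at h2
  rw [← h2, ← mul_assoc, ENNReal.mul_inv_cancel (pow_ne_zero _ hc0) (ENNReal.pow_ne_top hct),
    one_mul, Set.inter_comm]

/-! ### Memorylessness of the next departure -/

section Departure

variable {k : ℕ} [NeZero k] {r : ℝ}

/-- On the event that all jobs in `S` are in service when job `n` starts, their least residual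
service time exceeds `x` with probability `exp (-(r * x)) ^ S.card`, independently of the start
time: lowering the service times of these jobs by `x` leaves all start times up to `n` unchanged,
and `serviceLaw_shift` applies. -/
lemma serviceLaw_residual_gt (hr : 0 < r) (a : ℕ → ℝ) {n : ℕ} {S : Finset ℕ}
    (hS : ∀ m ∈ S, m ≤ n) {x : ℝ} (hx : 0 ≤ x) {I : Set ℝ} (hI : MeasurableSet I) :
    serviceLaw r {l | (∀ m ∈ S, queueStart k a l n + x < queueStart k a l m + l m) ∧
        queueStart k a l n ∈ I} =
      ENNReal.ofReal (Real.exp (-(r * x))) ^ S.card *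
        serviceLaw r {l | (∀ m ∈ S, queueStart k a l n < queueStart k a l m + l m) ∧
          queueStart k a l n ∈ I} := by
  have hv : ∀ m, Measurable fun l => queueStart k a l m := measurable_queueStart_left a
  rw [← serviceLaw_shift hr hx]
  · congr 1
    ext l
    set l' : ℕ → ℝ := fun m => if m ∈ S then l m - x else l m with hl'
    have hoff : ∀ m, m ∉ S → l' m = l m := fun m hm => by simp [hl', hm]
    have hon : ∀ m ∈ S, l' m = l m - x := fun m hm => by simp [hl', hm]
    simp only [Set.mem_ofPred_eq, Set.mem_inter_iff, Set.mem_preimage]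
    constructor
    · rintro ⟨h1, h2⟩
      have heq : ∀ j ≤ n, queueStart k a l' j = queueStart k a l j := fun j hj =>
        queueStart_eq_of_in_service hoff (fun m hm => by linarith [h1 m hm])
          (fun m hm => by rw [hon m hm]; linarith [h1 m hm]) hj
      refine ⟨fun m hm => ?_, fun m hm => ?_, ?_⟩
      · linarith [h1 m hm, queueStart_mono (k := k) a l (hS m hm)]
      · change queueStart k a l' n < queueStart k a l' m + l' m
        rw [heq n le_rfl, heq m (hS m hm), hon m hm]
        linarith [h1 m hm]
      · rwa [heq n le_rfl]
    · rintro ⟨-, h1, h2⟩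
      have heq : ∀ j ≤ n, queueStart k a l j = queueStart k a l' j := fun j hj =>
        queueStart_eq_of_in_service (fun m hm => (hoff m hm).symm) h1
          (fun m hm => by linarith [h1 m hm, hon m hm]) hj
      refine ⟨fun m hm => ?_, ?_⟩
      · rw [heq n le_rfl, heq m (hS m hm)]
        linarith [h1 m hm, hon m hm]
      · rwa [heq n le_rfl]
  · refine MeasurableSet.inter ?_ (hv n hI)
    have : {l : ℕ → ℝ | ∀ m ∈ S, queueStart k a l n < queueStart k a l m + l m} =
        ⋂ m ∈ S, {l | queueStart k a l n < queueStart k a l m + l m} := by ext; simp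
    change MeasurableSet {l : ℕ → ℝ | ∀ m ∈ S, queueStart k a l n < queueStart k a l m + l m}
    rw [this]
    exact Finset.measurableSet_biInter _ fun m _ =>
      measurableSet_lt (hv n) ((hv m).add (by fun_prop))

lemma MeasureTheory.Measure.ext_of_Ioi_of_univ {ν₁ ν₂ : Measure ℝ}
    [IsFiniteMeasure ν₁] [IsFiniteMeasure ν₂]
    (huniv : ν₁ Set.univ = ν₂ Set.univ) (h : ∀ b, ν₁ (Set.Ioi b) = ν₂ (Set.Ioi b)) : ν₁ = ν₂ := by
  refine Measure.ext_of_Iic _ _ fun b => ?_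
  rw [← Set.compl_Ioi, measure_compl measurableSet_Ioi (measure_ne_top _ _),
    measure_compl measurableSet_Ioi (measure_ne_top _ _), huniv, h]

lemma ofReal_exp_pow (k : ℕ) (r x : ℝ) :
    ENNReal.ofReal (Real.exp (-(r * x))) ^ k = ENNReal.ofReal (Real.exp (-(k * r * x))) := by
  rw [← ENNReal.ofReal_pow (Real.exp_pos _).le, ← Real.exp_nat_mul]
  congr 2
  ring

/-- On the event that the `k` jobs in `S` occupy all servers when job `n` starts, the time until
the next departure is an independent exponential variable with rate `k * r`. -/
lemma serviceLaw_all_in_service (hr : 0 < r) (a : ℕ → ℝ) {n : ℕ} {S : Finset ℕ}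
    (hS : ∀ m ∈ S, m ≤ n) (hcard : S.card = k) (t : ℝ) :
    serviceLaw r {l | queueStart k a l n ≤ t ∧ ∀ m ∈ S, t < queueStart k a l m + l m} =
      ∫⁻ l in {l | queueStart k a l n ≤ t ∧
          ∀ m ∈ S, queueStart k a l n < queueStart k a l m + l m},
        expMeasure (k * r) (Set.Ioi (t - queueStart k a l n)) ∂serviceLaw r := by
  have hkr : 0 < k * r := mul_pos (Nat.cast_pos.2 (NeZero.pos k)) hr
  have := isProbabilityMeasure_serviceLaw hr
  have := isProbabilityMeasure_expMeasure hkr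
  have hv : ∀ m, Measurable fun l => queueStart k a l m := measurable_queueStart_left a
  have hne : S.Nonempty := Finset.card_pos.1 (hcard ▸ NeZero.pos k)
  set N : (ℕ → ℝ) → ℝ := fun l =>
    S.inf' hne (fun m => queueStart k a l m + l m) - queueStart k a l n with hN
  have hNlt : ∀ l b, b < N l ↔ ∀ m ∈ S, queueStart k a l n + b < queueStart k a l m + l m := by
    intro l b
    rw [hN, lt_sub_iff_add_lt, Finset.lt_inf'_iff]
    simp only [add_comm b]
  have hNm : Measurable N := by
    refine measurable_of_Ioi fun b => ?_
    have : N ⁻¹' Set.Ioi b =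
        ⋂ m ∈ S, {l | queueStart k a l n + b < queueStart k a l m + l m} := by
      ext l; simp [hNlt]
    rw [this]
    exact Finset.measurableSet_biInter _ fun m _ =>
      measurableSet_lt ((hv n).add_const b) ((hv m).add (by fun_prop))
  set B : Set (ℕ → ℝ) := {l | 0 < N l} with hB
  have hjoint : ((serviceLaw r).restrict B).map (fun l => (queueStart k a l n, N l)) =
      (((serviceLaw r).restrict B).map fun l => queueStart k a l n).prod (expMeasure (k * r)) := by
    refine (Measure.prod_eq fun I J hI hJ => ?_).symm
    have hmeas : ((serviceLaw r).restrict (B ∩ (fun l => queueStart k a l n) ⁻¹' I)).map N =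
        (serviceLaw r (B ∩ (fun l => queueStart k a l n) ⁻¹' I)) • expMeasure (k * r) := by
      have : IsFiniteMeasure ((serviceLaw r (B ∩ (fun l => queueStart k a l n) ⁻¹' I)) •
          expMeasure (k * r)) := ⟨by simp⟩
      refine Measure.ext_of_Ioi_of_univ ?_ fun b => ?_
      · simp [Measure.map_apply hNm]
      · rw [Measure.map_apply hNm measurableSet_Ioi,
          Measure.restrict_apply (hNm measurableSet_Ioi), Measure.smul_apply, smul_eq_mul,
          expMeasure_Ioi hkr, mul_comm, ← ofReal_exp_pow]
        have h1 := serviceLaw_residual_gt (k := k) hr a hS (le_max_right b 0) hI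
        rw [hcard] at h1
        convert h1 using 2
        · ext l
          simp only [Set.mem_inter_iff, Set.mem_preimage, Set.mem_Ioi, hB, Set.mem_ofPred_eq,
            ← hNlt, max_lt_iff]
          tauto
        · congr 1
          ext l
          simp only [Set.mem_inter_iff, Set.mem_preimage, hB, Set.mem_ofPred_eq, hNlt, add_zero]
    have h2 := congrArg (fun ν => ν J) hmeas
    simp only [Measure.map_apply hNm hJ, Measure.restrict_apply (hNm hJ), Measure.smul_apply,
      smul_eq_mul] at h2
    rw [Measure.map_apply ((hv n).prodMk hNm) (hI.prod hJ),
      Measure.restrict_apply (((hv n).prodMk hNm) (hI.prod hJ)),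
      Measure.map_apply (hv n) hI, Measure.restrict_apply (hv n hI), Set.inter_comm _ B,
      Set.inter_comm _ B, ← h2]
    congr 1
    ext l
    simp only [Set.mem_inter_iff, Set.mem_preimage, Set.mem_prod]
    tauto
  have hC : MeasurableSet {p : ℝ × ℝ | p.1 ≤ t ∧ t < p.1 + p.2} :=
    (measurableSet_le measurable_fst measurable_const).inter
      (measurableSet_lt measurable_const (measurable_fst.add measurable_snd))
  have h3 := congrArg (fun ν => ν {p : ℝ × ℝ | p.1 ≤ t ∧ t < p.1 + p.2}) hjoint
  rw [Measure.map_apply ((hv n).prodMk hNm) hC, Measure.restrict_apply ((hv n).prodMk hNm hC),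
    Measure.prod_apply hC, lintegral_map (measurable_measure_prodMk_left hC) (hv n)] at h3
  have hset : {l | queueStart k a l n ≤ t ∧ ∀ m ∈ S, t < queueStart k a l m + l m} =
      (fun l => (queueStart k a l n, N l)) ⁻¹' {p : ℝ × ℝ | p.1 ≤ t ∧ t < p.1 + p.2} ∩ B := by
    ext l
    simp only [Set.mem_ofPred_eq, Set.mem_inter_iff, Set.mem_preimage, hB]
    have h4 := hNlt l (t - queueStart k a l n)
    simp only [add_sub_cancel] at h4
    rw [← h4, sub_lt_iff_lt_add']
    constructor
    · exact fun h => ⟨h, by linarith [h.1, h.2]⟩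
    · exact fun h => h.1
  have hset' : {l | queueStart k a l n ≤ t ∧
      ∀ m ∈ S, queueStart k a l n < queueStart k a l m + l m} =
      {l | queueStart k a l n ≤ t} ∩ B := by
    ext l
    have h4 := hNlt l 0
    simp only [add_zero] at h4
    simp only [Set.mem_ofPred_eq, Set.mem_inter_iff, hB, h4]
  have htm : MeasurableSet {l | queueStart k a l n ≤ t} := measurableSet_le (hv n) measurable_const
  rw [hset, h3, hset', ← Measure.restrict_restrict htm, ← lintegral_indicator htm]
  refine lintegral_congr fun l => ?_
  by_cases hl : queueStart k a l n ≤ t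
  · rw [Set.indicator_of_mem (by exact hl)]
    congr 1
    ext z
    simp [hl, sub_lt_iff_lt_add']
  · rw [Set.indicator_of_notMem (by exact hl)]
    simp [hl]

/-- The probability that job `n` starts after time `t`, for fixed arrival times `a`. -/
noncomputable def startTail (k : ℕ) [NeZero k] (r : ℝ) (a : ℕ → ℝ) (n : ℕ) (t : ℝ) : ENNReal :=
  serviceLaw r {l | t < queueStart k a l n}

lemma startTail_le_one (hr : 0 < r) (a : ℕ → ℝ) (n : ℕ) (t : ℝ) : startTail k r a n t ≤ 1 := by
  have := isProbabilityMeasure_serviceLaw hr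
  exact prob_le_one

/-- Given fixed arrival times, the start time of job `n + 1` is stochastically dominated by the
maximum of its arrival time and the start time of job `n` plus an independent exponential variable
with rate `k * r`. -/
lemma startTail_succ_le (hr : 0 < r) (a : ℕ → ℝ) (n : ℕ) {t : ℝ} (ht : a (n + 1) ≤ t) :
    startTail k r a (n + 1) t ≤ ∫⁻ z, startTail k r a n (t - z) ∂expMeasure (k * r) := by
  have hkr : 0 < k * r := mul_pos (Nat.cast_pos.2 (NeZero.pos k)) hr
  have := isProbabilityMeasure_serviceLaw hr
  have := isProbabilityMeasure_expMeasure hkr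
  have hv : ∀ m, Measurable fun l => queueStart k a l m := measurable_queueStart_left a
  set f : (ℕ → ℝ) → ENNReal := fun l => expMeasure (k * r) (Set.Ioi (t - queueStart k a l n))
    with hf
  set P := (Finset.range (n + 1)).powersetCard k with hP
  have hPS : ∀ S ∈ P, (∀ m ∈ S, m ≤ n) ∧ S.card = k := fun S hS => by
    rw [hP, Finset.mem_powersetCard] at hS
    exact ⟨fun m hm => Nat.lt_succ_iff.1 (Finset.mem_range.1 (hS.1 hm)), hS.2⟩
  set late : Set (ℕ → ℝ) := {l | t < queueStart k a l n} with hlate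
  have hlm : MeasurableSet late := measurableSet_lt measurable_const (hv n)
  set E : Finset ℕ → Set (ℕ → ℝ) := fun S =>
    {l | queueStart k a l n ≤ t ∧ ∀ m ∈ S, queueStart k a l n < queueStart k a l m + l m} with hE
  have hEm : ∀ S, MeasurableSet (E S) := fun S => by
    have : E S = {l | queueStart k a l n ≤ t} ∩
        ⋂ m ∈ S, {l | queueStart k a l n < queueStart k a l m + l m} := by ext; simp [hE]
    rw [this]
    exact (measurableSet_le (hv n) measurable_const).inter <|
      Finset.measurableSet_biInter _ fun m _ => measurableSet_lt (hv n) ((hv m).add (by fun_prop))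
  -- at most `k` jobs are in service at any time, so the set of `k` jobs in service is unique
  have hdisj : Set.PairwiseDisjoint (P : Set (Finset ℕ)) E := by
    intro S hS S' hS' hne
    rw [Function.onFun, Set.disjoint_left]
    rintro l ⟨-, h1⟩ ⟨-, h2⟩
    have hlt := card_lt_of_queueStart_le (k := k) a l n le_rfl
    set U := (Finset.range (n + 1)).filter
      fun m => queueStart k a l n < queueStart k a l m + l m with hU
    have hUc : U.card ≤ k := by
      rw [hU, Finset.range_add_one, Finset.filter_insert]
      split_ifs
      · exact (Finset.card_insert_le _ _).trans hlt
      · exact hlt.le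
    have hsub : ∀ T ∈ P, (∀ m ∈ T, queueStart k a l n < queueStart k a l m + l m) → T = U := by
      intro T hT h
      refine Finset.eq_of_subset_of_card_le (fun m hm => ?_) (hUc.trans (hPS T hT).2.ge)
      exact Finset.mem_filter.2 ⟨Finset.mem_range.2 (Nat.lt_succ_of_le ((hPS T hT).1 m hm)), h m hm⟩
    exact hne ((hsub S hS h1).trans (hsub S' hS' h2).symm)
  have hcover : {l | t < queueStart k a l (n + 1)} ⊆ late ∪
      ⋃ S ∈ P, {l | queueStart k a l n ≤ t ∧ ∀ m ∈ S, t < queueStart k a l m + l m} := by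
    intro l hl
    by_cases hn : t < queueStart k a l n
    · exact Or.inl hn
    right
    rcases (lt_queueStart_iff a l (n + 1) t).1 hl with h | ⟨m, hm, h⟩ | h
    · exact absurd h ht.not_gt
    · exact absurd (h.trans_le (queueStart_mono a l (Nat.lt_succ_iff.1 hm))) hn
    · obtain ⟨S, hS, hSk⟩ := Finset.exists_subset_card_eq h
      simp only [Set.mem_iUnion, exists_prop]
      exact ⟨S, Finset.mem_powersetCard.2 ⟨hS.trans (Finset.filter_subset _ _), hSk⟩,
        not_lt.1 hn, fun m hm => (Finset.mem_filter.1 (hS hm)).2⟩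
  have hunion : MeasurableSet (⋃ S ∈ P, E S) := Finset.measurableSet_biUnion _ fun S _ => hEm S
  have hld : Disjoint late (⋃ S ∈ P, E S) := by
    rw [Set.disjoint_left]
    intro l hl h
    simp only [Set.mem_iUnion, exists_prop] at h
    obtain ⟨S, -, h, -⟩ := h
    exact absurd hl h.not_gt
  calc startTail k r a (n + 1) t
      ≤ serviceLaw r late + ∑ S ∈ P, serviceLaw r
          {l | queueStart k a l n ≤ t ∧ ∀ m ∈ S, t < queueStart k a l m + l m} :=
        (measure_mono hcover).trans ((measure_union_le _ _).trans
          (by gcongr; exact measure_biUnion_finset_le _ _))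
    _ = ∫⁻ l in late, f l ∂serviceLaw r + ∑ S ∈ P, ∫⁻ l in E S, f l ∂serviceLaw r := by
        congr 1
        · rw [setLIntegral_congr_fun (g := fun _ => 1) hlm]
          · simp
          · intro l hl
            have hl' : t - queueStart k a l n ≤ 0 := by
              have : t < queueStart k a l n := hl
              linarith
            simp [hf, expMeasure_Ioi hkr, max_eq_right hl']
        · exact Finset.sum_congr rfl fun S hS =>
            serviceLaw_all_in_service hr a (hPS S hS).1 (hPS S hS).2 t
    _ = ∫⁻ l in late ∪ ⋃ S ∈ P, E S, f l ∂serviceLaw r := by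
        rw [lintegral_union hunion hld, lintegral_biUnion_finset hdisj fun S _ => hEm S]
    _ ≤ ∫⁻ l, f l ∂serviceLaw r := setLIntegral_le_lintegral _ _
    _ = ∫⁻ z, startTail k r a n (t - z) ∂expMeasure (k * r) := by
        have hm : MeasurableSet {p : (ℕ → ℝ) × ℝ | t < queueStart k a p.1 n + p.2} :=
          measurableSet_lt measurable_const (((hv n).comp measurable_fst).add measurable_snd)
        have h1 := Measure.prod_apply (μ := serviceLaw r) (ν := expMeasure (k * r)) hm
        rw [Measure.prod_apply_symm hm] at h1
        convert h1.symm using 1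
        · refine lintegral_congr fun l => ?_
          change expMeasure (k * r) _ = expMeasure (k * r) _
          congr 1
          ext z
          simp [sub_lt_iff_lt_add']
        · refine lintegral_congr fun z => ?_
          rw [startTail]
          congr 1
          ext l
          simp [sub_lt_iff_lt_add]

end Departure

/-! ### Tail bounds for waiting and sojourn times -/

section System

variable {Ω : Type*} [MeasurableSpace Ω] {P : Measure Ω} [IsProbabilityMeasure P] {k : ℕ} {μ : ℝ}
  {A L V : ℕ → Ω → ℝ} {s : ℕ → Ω → Fin k}

lemma IsGMkSystem.map_prod (hsys : IsGMkSystem P k μ A L V s) :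
    P.map (fun ω => ((fun n => A n ω), fun n => L n ω)) =
      (P.map fun ω n => A n ω).prod (serviceLaw μ) := by
  have hA : Measurable fun ω n => A n ω := measurable_pi_lambda _ hsys.measurable_arrival
  have hL : Measurable fun ω n => L n ω := measurable_pi_lambda _ hsys.measurable_service
  rw [(indepFun_iff_map_prod_eq_prod_map_map hA.aemeasurable hL.aemeasurable).1
    hsys.arrival_indep_service, hsys.service_indep.map_fun_eq_infinitePi_map hsys.measurable_service]
  simp only [hsys.service_law, serviceLaw]

/-- As the arrival times increase, the moment generating function of `A n - A m` at `-θ` is an honest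
integral. -/
lemma IsGMkSystem.ofReal_mgf (hsys : IsGMkSystem P k μ A L V s) {θ : ℝ} (hθ : 0 < θ) {m n : ℕ}
    (hmn : m ≤ n) :
    Integrable (fun ω => Real.exp (-θ * (A n ω - A m ω))) P ∧
    ∫⁻ ω, ENNReal.ofReal (Real.exp (-θ * (A n ω - A m ω))) ∂P =
      ENNReal.ofReal (mgf (fun ω => A n ω - A m ω) P (-θ)) := by
  have hn := hsys.measurable_arrival n
  have hm := hsys.measurable_arrival m
  have hint : Integrable (fun ω => Real.exp (-θ * (A n ω - A m ω))) P := by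
    refine Integrable.of_bound (by fun_prop) 1 ?_
    filter_upwards [hsys.arrival_mono] with ω hω
    rw [Real.norm_eq_abs, Real.abs_exp, Real.exp_le_one_iff]
    have : A m ω ≤ A n ω := hω hmn
    exact mul_nonpos_of_nonpos_of_nonneg (by linarith) (by linarith)
  exact ⟨hint, (ofReal_integral_eq_lintegral_ofReal hint
    (ae_of_all _ fun ω => (Real.exp_pos _).le)).symm⟩

end System

lemma exp_mul_rhoZ {k : ℕ} {μ θ : ℝ} (hθ : 0 < θ) (hθr : θ < k * μ) :
    Real.exp (θ * rhoZ k μ θ) = k * μ / (k * μ - θ) := by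
  have : 0 < k * μ / (k * μ - θ) := div_pos (hθ.trans hθr) (sub_pos.2 hθr)
  rw [rhoZ, ← mul_assoc, mul_one_div_cancel hθ.ne', one_mul, Real.exp_log this]

lemma measurable_dite_mem_range (n i : ℕ) : Measurable fun y : Finset.range n → ℝ =>
    if h : i ∈ Finset.range n then y ⟨i, h⟩ else 0 := by
  split_ifs with h
  · exact measurable_pi_apply _
  · exact measurable_const

section Tail

variable {k : ℕ} [NeZero k] {r : ℝ}

lemma measurable_startTail (hr : 0 < r) (n : ℕ) :
    Measurable fun p : (ℕ → ℝ) × ℝ => startTail k r p.1 n p.2 := by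
  have := isProbabilityMeasure_serviceLaw hr
  have hm : MeasurableSet {p : ((ℕ → ℝ) × ℝ) × (ℕ → ℝ) | p.1.2 < queueStart k p.1.1 p.2 n} :=
    measurableSet_lt (by fun_prop) ((measurable_queueStart n).comp
      (by fun_prop : Measurable fun p : ((ℕ → ℝ) × ℝ) × (ℕ → ℝ) => (p.1.1, p.2)))
  exact measurable_measure_prodMk_left hm

/-- Iterating `startTail_succ_le` on exponential bounds, with `k * r / (k * r - θ)` the moment
generating function at `θ` of the exponential distribution with rate `k * r`. -/
lemma startTail_le_sum (hr : 0 < r) {θ : ℝ} (hθ : 0 < θ) (hθr : θ < k * r) (a : ℕ → ℝ)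
    (n : ℕ) (t : ℝ) :
    startTail k r a n t ≤ ENNReal.ofReal (∑ m ∈ Finset.range (n + 1),
      (k * r / (k * r - θ)) ^ (n - m) * Real.exp (θ * (a m - t))) := by
  set M := k * r / (k * r - θ) with hM
  have hM0 : 0 < M := div_pos (hθ.trans hθr) (sub_pos.2 hθr)
  have early : ∀ n t, t < a n → startTail k r a n t ≤ ENNReal.ofReal
      (∑ m ∈ Finset.range (n + 1), M ^ (n - m) * Real.exp (θ * (a m - t))) := by
    intro n t ht
    refine (startTail_le_one hr a n t).trans (ENNReal.one_le_ofReal.2 ?_)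
    calc (1 : ℝ) ≤ M ^ (n - n) * Real.exp (θ * (a n - t)) := by
          simpa using (mul_pos hθ (sub_pos.2 ht)).le
      _ ≤ _ := Finset.single_le_sum (f := fun m => M ^ (n - m) * Real.exp (θ * (a m - t)))
          (fun m _ => by positivity) (Finset.self_mem_range_succ n)
  induction n generalizing t with
  | zero =>
    by_cases ht : t < a 0
    · exact early 0 t ht
    · simp [startTail, queueStart_zero, ht]
  | succ n ih =>
    by_cases ht : t < a (n + 1)
    · exact early _ t ht
    set C := ∑ m ∈ Finset.range (n + 1), M ^ (n - m) * Real.exp (θ * (a m - t)) with hC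
    have hC0 : 0 ≤ C := Finset.sum_nonneg fun m _ => by positivity
    calc startTail k r a (n + 1) t
        ≤ ∫⁻ z, startTail k r a n (t - z) ∂expMeasure (k * r) :=
          startTail_succ_le hr a n (not_lt.1 ht)
      _ ≤ ∫⁻ z, ENNReal.ofReal C * ENNReal.ofReal (Real.exp (θ * z)) ∂expMeasure (k * r) := by
          refine lintegral_mono fun z => (ih (t - z)).trans (le_of_eq ?_)
          rw [← ENNReal.ofReal_mul hC0, hC, Finset.sum_mul]
          refine congrArg _ (Finset.sum_congr rfl fun m _ => ?_)
          rw [mul_assoc, ← Real.exp_add]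
          ring_nf
      _ = ENNReal.ofReal (C * M) := by
          rw [lintegral_const_mul _ (by fun_prop),
            lintegral_exp_expMeasure (hθ.trans hθr) hθr, ENNReal.ofReal_mul hC0]
      _ ≤ _ := by
          refine ENNReal.ofReal_le_ofReal ?_
          rw [Finset.sum_range_succ _ (n + 1), hC, Finset.sum_mul]
          refine le_add_of_le_of_nonneg (le_of_eq (Finset.sum_congr rfl fun m hm => ?_))
            (by positivity)
          rw [Nat.succ_sub (Nat.lt_succ_iff.1 (Finset.mem_range.1 hm)), pow_succ]
          ring

variable {Ω : Type*} [MeasurableSpace Ω] {P : Measure Ω} [IsProbabilityMeasure P]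

/-- The probability that job `n` of the system with arrivals `A` and independent exponential
services waits longer than `τ`, as an average over the arrivals. -/
noncomputable def waitTail (P : Measure Ω) (k : ℕ) [NeZero k] (r : ℝ) (A : ℕ → Ω → ℝ) (n : ℕ)
    (τ : ℝ) : ENNReal :=
  ∫⁻ ω, startTail k r (fun m => A m ω) n (A n ω + τ) ∂P

lemma waitTail_le_one (hr : 0 < r) (A : ℕ → Ω → ℝ) (n : ℕ) (τ : ℝ) :
    waitTail P k r A n τ ≤ 1 :=
  (lintegral_mono fun _ => startTail_le_one hr _ _ _).trans (by simp)

/-- The start time of a job is independent of its own service time, so the law of the departure time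
is a convolution. -/
lemma serviceLaw_lt_start_add_service (hr : 0 < r) (a : ℕ → ℝ) (n : ℕ) (t : ℝ) :
    serviceLaw r {l | t < queueStart k a l n + l n} =
      ∫⁻ y, startTail k r a n (t - y) ∂expMeasure r := by
  have := isProbabilityMeasure_expMeasure hr
  have := isProbabilityMeasure_serviceLaw hr
  have hv : ∀ m, Measurable fun l => queueStart k a l m := measurable_queueStart_left a
  have hind : iIndepFun (fun (i : ℕ) (l : ℕ → ℝ) => l i) (serviceLaw r) :=
    iIndepFun_infinitePi (P := fun _ : ℕ => expMeasure r) (X := fun _ y => y)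
      fun _ => measurable_id
  let e : (Finset.range n → ℝ) → ℕ → ℝ := fun y i =>
    if h : i ∈ Finset.range n then y ⟨i, h⟩ else 0
  have he : Measurable e := measurable_pi_lambda _ (measurable_dite_mem_range n)
  have hind2 : IndepFun (fun l => queueStart k a l n) (fun l : ℕ → ℝ => l n) (serviceLaw r) := by
    have h := hind.indepFun_finset (Finset.range n) {n} (by simp) fun i => measurable_pi_apply i
    have hψ : Measurable fun y : (({n} : Finset ℕ) → ℝ) => y ⟨n, Finset.mem_singleton_self n⟩ :=
      measurable_pi_apply _
    have h' := h.comp (φ := fun y => queueStart k a (e y) n)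
      (ψ := fun y : (({n} : Finset ℕ) → ℝ) => y ⟨n, Finset.mem_singleton_self n⟩)
      ((hv n).comp he) hψ
    convert h' using 1
    · ext l
      exact queueStart_congr n fun m hm => by simp [e, hm]
    · rfl
  have hn : (serviceLaw r).map (fun l : ℕ → ℝ => l n) = expMeasure r :=
    Measure.infinitePi_map_eval _ n
  have hm : MeasurableSet {p : ℝ × ℝ | t < p.1 + p.2} :=
    measurableSet_lt measurable_const (measurable_fst.add measurable_snd)
  have h1 := congrArg (fun ν => ν {p : ℝ × ℝ | t < p.1 + p.2})
    ((indepFun_iff_map_prod_eq_prod_map_map (hv n).aemeasurable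
      (measurable_pi_apply n).aemeasurable).1 hind2)
  rw [hn] at h1
  simp only [Measure.map_apply ((hv n).prodMk (measurable_pi_apply n)) hm] at h1
  have := Measure.isProbabilityMeasure_map (μ := serviceLaw r) (hv n).aemeasurable
  rw [Measure.prod_apply_symm hm] at h1
  refine h1.trans (lintegral_congr fun y => ?_)
  rw [Measure.map_apply (hv n) (measurable_prodMk_right hm), startTail]
  congr 1
  ext l
  simp [sub_lt_iff_lt_add]

variable {μ : ℝ} {A L V : ℕ → Ω → ℝ} {s : ℕ → Ω → Fin k}

lemma IsGMkSystem.measure_waiting_le (hsys : IsGMkSystem P k μ A L V s) (n : ℕ) (τ : ℝ) :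
    P {ω | waitingTime A V n ω > τ} ≤ waitTail P k μ A n τ := by
  have := isProbabilityMeasure_serviceLaw hsys.rate_pos
  have hA : Measurable fun ω n => A n ω := measurable_pi_lambda _ hsys.measurable_arrival
  have hL : Measurable fun ω n => L n ω := measurable_pi_lambda _ hsys.measurable_service
  have hm : MeasurableSet {p : (ℕ → ℝ) × (ℕ → ℝ) | p.1 n + τ < queueStart k p.1 p.2 n} :=
    measurableSet_lt (by fun_prop) (measurable_queueStart n)
  calc P {ω | waitingTime A V n ω > τ}
      ≤ P ((fun ω => ((fun n => A n ω), fun n => L n ω)) ⁻¹'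
          {p : (ℕ → ℝ) × (ℕ → ℝ) | p.1 n + τ < queueStart k p.1 p.2 n}) := by
        refine measure_mono_ae ?_
        filter_upwards [hsys.path] with ω hω h
        have h1 : τ < V n ω - A n ω := h
        have h2 := hω.start_le_queueStart n
        change A n ω + τ < queueStart k (fun n => A n ω) (fun n => L n ω) n
        linarith
    _ = waitTail P k μ A n τ := by
        rw [← Measure.map_apply (hA.prodMk hL) hm, hsys.map_prod, Measure.prod_apply hm,
          lintegral_map (measurable_measure_prodMk_left hm) hA]
        rfl

lemma IsGMkSystem.measure_sojourn_le (hsys : IsGMkSystem P k μ A L V s) (n : ℕ) (τ : ℝ) :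
    P {ω | sojournTime A L V n ω > τ} ≤ ∫⁻ y, waitTail P k μ A n (τ - y) ∂expMeasure μ := by
  have := isProbabilityMeasure_serviceLaw hsys.rate_pos
  have := isProbabilityMeasure_expMeasure hsys.rate_pos
  have hA : Measurable fun ω n => A n ω := measurable_pi_lambda _ hsys.measurable_arrival
  have hL : Measurable fun ω n => L n ω := measurable_pi_lambda _ hsys.measurable_service
  have hm : MeasurableSet
      {p : (ℕ → ℝ) × (ℕ → ℝ) | p.1 n + τ < queueStart k p.1 p.2 n + p.2 n} :=
    measurableSet_lt (by fun_prop) ((measurable_queueStart n).add (by fun_prop))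
  calc P {ω | sojournTime A L V n ω > τ}
      ≤ P ((fun ω => ((fun n => A n ω), fun n => L n ω)) ⁻¹'
          {p : (ℕ → ℝ) × (ℕ → ℝ) | p.1 n + τ < queueStart k p.1 p.2 n + p.2 n}) := by
        refine measure_mono_ae ?_
        filter_upwards [hsys.path] with ω hω h
        have h1 : τ < (V n ω + L n ω) - A n ω := h
        have h2 := hω.start_le_queueStart n
        change A n ω + τ < queueStart k (fun n => A n ω) (fun n => L n ω) n + L n ω
        linarith
    _ = ∫⁻ ω, ∫⁻ y, startTail k μ (fun m => A m ω) n (A n ω + τ - y) ∂expMeasure μ ∂P := by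
        rw [← Measure.map_apply (hA.prodMk hL) hm, hsys.map_prod, Measure.prod_apply hm,
          lintegral_map (measurable_measure_prodMk_left hm) hA]
        exact lintegral_congr fun ω => serviceLaw_lt_start_add_service (k := k) hsys.rate_pos
          (fun m => A m ω) n (A n ω + τ)
    _ = ∫⁻ y, waitTail P k μ A n (τ - y) ∂expMeasure μ := by
        rw [lintegral_lintegral_swap]
        · simp only [waitTail, add_sub_assoc]
        · have hAn := hsys.measurable_arrival n
          exact ((measurable_startTail hsys.rate_pos n).comp
            ((hA.comp measurable_fst).prodMk (((hAn.comp measurable_fst).add_const τ).sub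
              measurable_snd))).aemeasurable

/-- An exponential bound on the waiting time yields the bound on the sojourn time by convolution
with the service time distribution. -/
lemma IsGMkSystem.bounds_of_waitTail_le (hsys : IsGMkSystem P k μ A L V s) {θ α : ℝ}
    (hθ : θ ≠ μ) (hα : 0 ≤ α) (n : ℕ)
    (h : ∀ τ, waitTail P k μ A n τ ≤ ENNReal.ofReal (α * Real.exp (-θ * τ))) :
    (∀ τ : ℝ, 0 ≤ τ → P.real {ω | sojournTime A L V n ω > τ} ≤
      α * (μ / (μ - θ)) * (Real.exp (-θ * τ) - Real.exp (-μ * τ)) + Real.exp (-μ * τ)) ∧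
    (∀ τ : ℝ, P.real {ω | waitingTime A V n ω > τ} ≤ α * Real.exp (-θ * τ)) := by
  have hμ := hsys.rate_pos
  refine ⟨fun τ hτ => ?_, fun τ => ?_⟩
  · set K := μ / (μ - θ) * (1 - Real.exp ((θ - μ) * τ)) with hK
    have hK0 : 0 ≤ K := by
      rcases lt_or_gt_of_ne hθ with h1 | h1
      · refine mul_nonneg (div_pos hμ (sub_pos.2 h1)).le (sub_nonneg.2 (Real.exp_le_one_iff.2 ?_))
        exact mul_nonpos_of_nonpos_of_nonneg (sub_neg.2 h1).le hτ
      · refine mul_nonneg_of_nonpos_of_nonpos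
          (div_neg_of_pos_of_neg hμ (sub_neg.2 h1)).le (sub_nonpos.2 (Real.one_le_exp ?_))
        exact mul_nonneg (sub_pos.2 h1).le hτ
    have hfin : α * (μ / (μ - θ)) * (Real.exp (-θ * τ) - Real.exp (-μ * τ)) + Real.exp (-μ * τ) =
        α * Real.exp (-θ * τ) * K + Real.exp (-μ * τ) := by
      have : Real.exp (-μ * τ) = Real.exp (-θ * τ) * Real.exp ((θ - μ) * τ) := by
        rw [← Real.exp_add]; ring_nf
      rw [hK, this]
      ring
    rw [hfin]
    refine ENNReal.toReal_le_of_le_ofReal (by positivity) ?_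
    refine (hsys.measure_sojourn_le n τ).trans ?_
    rw [← lintegral_add_compl _ (measurableSet_Iic (a := τ)), Set.compl_Iic,
      ENNReal.ofReal_add (by positivity) (by positivity), ENNReal.ofReal_mul (by positivity), hK,
      ← setLIntegral_exp_expMeasure hμ hθ hτ]
    refine add_le_add ?_ ?_
    · rw [← lintegral_const_mul _ (by fun_prop)]
      refine lintegral_mono fun y => (h _).trans (le_of_eq ?_)
      rw [← ENNReal.ofReal_mul (by positivity), mul_assoc, ← Real.exp_add]
      ring_nf
    · calc ∫⁻ y in Set.Ioi τ, waitTail P k μ A n (τ - y) ∂expMeasure μ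
          ≤ ∫⁻ _ in Set.Ioi τ, 1 ∂expMeasure μ :=
            lintegral_mono fun y => waitTail_le_one hμ A n _
        _ = ENNReal.ofReal (Real.exp (-μ * τ)) := by
            rw [setLIntegral_one, expMeasure_Ioi hμ, max_eq_left hτ, neg_mul]
  · exact ENNReal.toReal_le_of_le_ofReal (by positivity) ((hsys.measure_waiting_le n τ).trans (h τ))

/-- Integrating `startTail_le_sum` over the arrivals turns the sum into a geometric series. -/
lemma IsGMkSystem.waitTail_le_of_isLowerConstrained (hsys : IsGMkSystem P k μ A L V s) {θ : ℝ}
    (hθ : 0 < θ) (hθr : θ < k * μ) {σA ρA : ℝ → ℝ} (hA : IsLowerConstrained P A σA ρA)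
    (hρ : rhoZ k μ θ < ρA (-θ)) (n : ℕ) (τ : ℝ) :
    waitTail P k μ A n τ ≤ ENNReal.ofReal (Real.exp (θ * σA (-θ)) /
      (1 - Real.exp (-θ * (ρA (-θ) - rhoZ k μ θ))) * Real.exp (-θ * τ)) := by
  set M := k * μ / (k * μ - θ) with hM
  have hM0 : 0 < M := div_pos (hθ.trans hθr) (sub_pos.2 hθr)
  set q := Real.exp (-θ * (ρA (-θ) - rhoZ k μ θ)) with hq
  have hq1 : q < 1 := Real.exp_lt_one_iff.2 (by nlinarith)
  have hterm : ∀ m ∈ Finset.range (n + 1),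
      ∫⁻ ω, ENNReal.ofReal (M ^ (n - m) * Real.exp (θ * (A m ω - (A n ω + τ)))) ∂P ≤
        ENNReal.ofReal (Real.exp (-θ * τ) * Real.exp (θ * σA (-θ)) * q ^ (n - m)) := by
    intro m hm
    have hmn : m ≤ n := Nat.lt_succ_iff.1 (Finset.mem_range.1 hm)
    have h1 : ∀ ω, ENNReal.ofReal (M ^ (n - m) * Real.exp (θ * (A m ω - (A n ω + τ)))) =
        ENNReal.ofReal (M ^ (n - m) * Real.exp (-θ * τ)) *
          ENNReal.ofReal (Real.exp (-θ * (A n ω - A m ω))) := fun ω => by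
      rw [← ENNReal.ofReal_mul (by positivity), mul_assoc, ← Real.exp_add]
      ring_nf
    have hn' := hsys.measurable_arrival n
    have hm' := hsys.measurable_arrival m
    simp_rw [h1]
    rw [lintegral_const_mul _ (by fun_prop), (hsys.ofReal_mgf hθ hmn).2,
      ← ENNReal.ofReal_mul (by positivity)]
    refine ENNReal.ofReal_le_ofReal ((mul_le_mul_of_nonneg_left (hA θ hθ m n hmn)
      (by positivity)).trans (le_of_eq ?_))
    rw [hM, ← exp_mul_rhoZ hθ hθr, hq, ← Real.exp_nat_mul, ← Real.exp_nat_mul, ← Real.exp_add,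
      ← Real.exp_add, ← Real.exp_add, ← Real.exp_add, Nat.cast_sub hmn]
    ring_nf
  calc waitTail P k μ A n τ
      ≤ ∫⁻ ω, ENNReal.ofReal (∑ m ∈ Finset.range (n + 1),
          M ^ (n - m) * Real.exp (θ * (A m ω - (A n ω + τ)))) ∂P :=
        lintegral_mono fun ω => startTail_le_sum hsys.rate_pos hθ hθr _ n _
    _ = ∑ m ∈ Finset.range (n + 1),
          ∫⁻ ω, ENNReal.ofReal (M ^ (n - m) * Real.exp (θ * (A m ω - (A n ω + τ)))) ∂P := by
        rw [← lintegral_finsetSum]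
        · exact lintegral_congr fun ω => ENNReal.ofReal_sum_of_nonneg fun m _ => by positivity
        · intro m _
          have hn' := hsys.measurable_arrival n
          have hm' := hsys.measurable_arrival m
          fun_prop
    _ ≤ ∑ m ∈ Finset.range (n + 1),
          ENNReal.ofReal (Real.exp (-θ * τ) * Real.exp (θ * σA (-θ)) * q ^ (n - m)) :=
        Finset.sum_le_sum hterm
    _ = ENNReal.ofReal (Real.exp (-θ * τ) * Real.exp (θ * σA (-θ)) *
          ∑ m ∈ Finset.range (n + 1), q ^ (n - m)) := by
        rw [Finset.mul_sum, ENNReal.ofReal_sum_of_nonneg fun m _ => by positivity]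
    _ ≤ _ := by
        refine ENNReal.ofReal_le_ofReal ?_
        have hgeom : ∑ m ∈ Finset.range (n + 1), q ^ (n - m) ≤ (1 - q)⁻¹ := by
          have h2 := Finset.sum_range_reflect (fun j => q ^ j) (n + 1)
          simp only [Nat.add_sub_cancel] at h2
          rw [show ∑ m ∈ Finset.range (n + 1), q ^ (n - m) = ∑ j ∈ Finset.range (n + 1), q ^ j by
            rw [← h2], ← tsum_geometric_of_lt_one (Real.exp_pos _).le hq1]
          exact (summable_geometric_of_lt_one (Real.exp_pos _).le hq1).sum_le_tsum _
            fun j _ => by positivity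
        calc _ ≤ Real.exp (-θ * τ) * Real.exp (θ * σA (-θ)) * (1 - q)⁻¹ := by gcongr
          _ = _ := by rw [div_eq_mul_inv]; ring

/-- For independent inter-arrival times, the waiting time of job `n` is independent of the time
between the arrivals of the jobs `n` and `n + 1`. -/
lemma HasIIDInterarrivals.lintegral_startTail (hA : HasIIDInterarrivals P A)
    (hm : ∀ n, Measurable (A n)) (hr : 0 < r) (n : ℕ) (c : ℝ) :
    ∫⁻ ω, startTail k r (fun m => A m ω) n (A (n + 1) ω + c) ∂P =
      ∫⁻ ω, waitTail P k r A n ((A (n + 1) ω - A n ω) + c) ∂P := by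
  -- the arrival times up to job `n`, counted from the arrival of job `0`, as a function of the
  -- inter-arrival times before job `n`
  let b : (Finset.range n → ℝ) → ℕ → ℝ := fun y m =>
    ∑ i ∈ Finset.range m, if h : i ∈ Finset.range n then y ⟨i, h⟩ else 0
  have hb : Measurable b := measurable_pi_lambda _ fun m =>
    Finset.measurable_sum _ fun i _ => measurable_dite_mem_range n i
  have hX : ∀ i, Measurable fun ω => A (i + 1) ω - A i ω := fun i => (hm (i + 1)).sub (hm i)
  let Y : Ω → (Finset.range n → ℝ) := fun ω i => A (i + 1) ω - A i ω
  have hY : Measurable Y := measurable_pi_lambda _ fun i => hX i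
  have hbY : ∀ ω, ∀ m ≤ n, A m ω = b (Y ω) m + A 0 ω := by
    intro ω m hmn
    have : b (Y ω) m = ∑ i ∈ Finset.range m, (A (i + 1) ω - A i ω) :=
      Finset.sum_congr rfl fun i hi =>
        dif_pos (Finset.mem_range.2 ((Finset.mem_range.1 hi).trans_le hmn))
    rw [this, Finset.sum_range_sub fun i => A i ω]
    ring
  have htail : ∀ ω u, startTail k r (fun m => A m ω) n (A n ω + u) =
      startTail k r (b (Y ω)) n (b (Y ω) n + u) := by
    intro ω u
    rw [startTail, startTail]
    congr 1
    ext l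
    rw [Set.mem_ofPred_eq, Set.mem_ofPred_eq, queueStart_eq_add n (hbY ω) (fun m _ => rfl),
      hbY ω n le_rfl]
    constructor <;> intro h <;> linarith
  have hind : IndepFun Y (fun ω => A (n + 1) ω - A n ω) P :=
    (hA.indep.indepFun_finset (Finset.range n) {n} (by simp) hX).comp (φ := id)
      (ψ := fun y : (({n} : Finset ℕ) → ℝ) => y ⟨n, Finset.mem_singleton_self n⟩)
      measurable_id (measurable_pi_apply _)
  have hprod := (indepFun_iff_map_prod_eq_prod_map_map hY.aemeasurable (hX n).aemeasurable).1 hind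
  have hG : Measurable fun p : (Finset.range n → ℝ) × ℝ =>
      startTail k r (b p.1) n (b p.1 n + (p.2 + c)) := by
    have h1 : Measurable fun p : (Finset.range n → ℝ) × ℝ => b p.1 := hb.comp measurable_fst
    exact (measurable_startTail hr n).comp
      (h1.prodMk (((measurable_pi_apply n).comp h1).add (measurable_snd.add_const c)))
  have hPY := Measure.isProbabilityMeasure_map (μ := P) hY.aemeasurable
  have hPX := Measure.isProbabilityMeasure_map (μ := P) (hX n).aemeasurable
  calc ∫⁻ ω, startTail k r (fun m => A m ω) n (A (n + 1) ω + c) ∂P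
      = ∫⁻ ω, startTail k r (b (Y ω)) n (b (Y ω) n + ((A (n + 1) ω - A n ω) + c)) ∂P := by
        refine lintegral_congr fun ω => ?_
        rw [← htail]
        congr 1
        ring
    _ = ∫⁻ p, startTail k r (b p.1) n (b p.1 n + (p.2 + c))
          ∂((P.map Y).prod (P.map fun ω => A (n + 1) ω - A n ω)) := by
        rw [← hprod, lintegral_map hG (hY.prodMk (hX n))]
    _ = ∫⁻ x, ∫⁻ y, startTail k r (b y) n (b y n + (x + c)) ∂(P.map Y)
          ∂(P.map fun ω => A (n + 1) ω - A n ω) := lintegral_prod_symm _ hG.aemeasurable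
    _ = _ := by
        have hGx : ∀ x : ℝ, Measurable fun y : Finset.range n → ℝ =>
            startTail k r (b y) n (b y n + (x + c)) := fun x =>
          Measurable.of_uncurry_right
            (f := fun y x => startTail k r (b y) n (b y n + (x + c))) hG
        have hwait : ∀ x : ℝ, ∫⁻ y, startTail k r (b y) n (b y n + (x + c)) ∂(P.map Y) =
            waitTail P k r A n (x + c) := fun x => by
          rw [lintegral_map (hGx x) hY, waitTail]
          exact lintegral_congr fun ω => (htail ω _).symm
        rw [lintegral_map hG.lintegral_prod_left' (hX n)]
        exact lintegral_congr fun ω => hwait _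

/-- Induction on the job: no union bound is needed, since the increments of the dominating random
walk are independent of the waiting time and have moment generating function at most one. -/
lemma IsGMkSystem.waitTail_le_of_hasIIDInterarrivals (hsys : IsGMkSystem P k μ A L V s) {θ : ℝ}
    (hθ : 0 < θ) (hθr : θ < k * μ) (hA : HasIIDInterarrivals P A)
    (hρ : rhoZ k μ θ ≤ giArrivalRate P A θ) (n : ℕ) (τ : ℝ) :
    waitTail P k μ A n τ ≤ ENNReal.ofReal (Real.exp (-θ * τ)) := by
  have hμ := hsys.rate_pos
  have hm := hsys.measurable_arrival
  have hkμ : 0 < k * μ := hθ.trans hθr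
  have := isProbabilityMeasure_expMeasure hkμ
  set M := k * μ / (k * μ - θ) with hM
  have hM0 : 0 < M := div_pos hkμ (sub_pos.2 hθr)
  set R := mgf (fun ω => A 1 ω - A 0 ω) P (-θ) with hR
  obtain ⟨hint, hmgf⟩ := hsys.ofReal_mgf hθ (Nat.zero_le 1)
  have hR0 : 0 < R := mgf_pos hint
  -- the stability condition says that the increments of the random walk which dominates the
  -- waiting time have moment generating function at most one at `θ`
  have hMR : R * M ≤ 1 := by
    have h1 : θ * giArrivalRate P A θ = -Real.log R := by
      rw [giArrivalRate, ← mul_assoc, mul_neg, mul_one_div_cancel hθ.ne', neg_one_mul]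
    have h2 := mul_le_mul_of_nonneg_left hρ hθ.le
    rw [h1] at h2
    have h3 := Real.exp_le_exp.2 h2
    rw [exp_mul_rhoZ hθ hθr, Real.exp_neg, Real.exp_log hR0] at h3
    calc R * M ≤ R * R⁻¹ := by gcongr
      _ = 1 := mul_inv_cancel₀ hR0.ne'
  have neg_case : ∀ n τ, τ < 0 → waitTail P k μ A n τ ≤ ENNReal.ofReal (Real.exp (-θ * τ)) :=
    fun n τ hτ => (waitTail_le_one hμ A n τ).trans
      (ENNReal.one_le_ofReal.2 (Real.one_le_exp (by nlinarith)))
  induction n generalizing τ with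
  | zero =>
    rcases lt_or_ge τ 0 with hτ | hτ
    · exact neg_case 0 τ hτ
    · simp [waitTail, startTail, queueStart_zero, hτ.not_gt]
  | succ n ih =>
    rcases lt_or_ge τ 0 with hτ | hτ
    · exact neg_case _ τ hτ
    have hstep : ∀ x z : ℝ, waitTail P k μ A n (x + (τ - z)) ≤
        ENNReal.ofReal (Real.exp (-θ * τ)) * ENNReal.ofReal (Real.exp (θ * z)) *
          ENNReal.ofReal (Real.exp (-θ * x)) := fun x z => by
      refine (ih _).trans (le_of_eq ?_)
      rw [← ENNReal.ofReal_mul (by positivity), ← ENNReal.ofReal_mul (by positivity),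
        ← Real.exp_add, ← Real.exp_add]
      ring_nf
    have hlaw : ∫⁻ ω, ENNReal.ofReal (Real.exp (-θ * (A (n + 1) ω - A n ω))) ∂P =
        ENNReal.ofReal R := by
      rw [hR, ← hmgf]
      have hu : Measurable fun x : ℝ => ENNReal.ofReal (Real.exp (-θ * x)) := by fun_prop
      exact ((hA.identDistrib n).comp hu).lintegral_eq
    have hmA : Measurable fun ω m => A m ω := measurable_pi_lambda _ hm
    have hm0 := hm n
    have hm1 := hm (n + 1)
    calc waitTail P k μ A (n + 1) τ
        ≤ ∫⁻ ω, ∫⁻ z, startTail k μ (fun m => A m ω) n (A (n + 1) ω + τ - z)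
            ∂expMeasure (k * μ) ∂P :=
          lintegral_mono fun ω => startTail_succ_le hμ _ n (by linarith)
      _ = ∫⁻ z, ∫⁻ ω, startTail k μ (fun m => A m ω) n (A (n + 1) ω + (τ - z)) ∂P
            ∂expMeasure (k * μ) := by
          rw [lintegral_lintegral_swap]
          · simp only [add_sub_assoc]
          · exact ((measurable_startTail hμ n).comp
              ((hmA.comp measurable_fst).prodMk (((hm1.comp measurable_fst).add_const τ).sub
                measurable_snd))).aemeasurable
      _ = ∫⁻ z, ∫⁻ ω, waitTail P k μ A n ((A (n + 1) ω - A n ω) + (τ - z)) ∂P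
            ∂expMeasure (k * μ) :=
          lintegral_congr fun z => hA.lintegral_startTail hm hμ n _
      _ ≤ ∫⁻ z, ENNReal.ofReal (Real.exp (-θ * τ)) * ENNReal.ofReal (Real.exp (θ * z)) *
            ENNReal.ofReal R ∂expMeasure (k * μ) := by
          refine lintegral_mono fun z => ?_
          rw [← hlaw, ← lintegral_const_mul _ (by fun_prop)]
          exact lintegral_mono fun ω => hstep _ z
      _ = ENNReal.ofReal (Real.exp (-θ * τ) * (R * M)) := by
          rw [lintegral_mul_const _ (by fun_prop), lintegral_const_mul _ (by fun_prop),
            lintegral_exp_expMeasure hkμ hθr, ← ENNReal.ofReal_mul (by positivity),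
            ← ENNReal.ofReal_mul (by positivity)]
          congr 1
          ring
      _ ≤ ENNReal.ofReal (Real.exp (-θ * τ)) :=
          ENNReal.ofReal_le_ofReal (mul_le_of_le_one_right (Real.exp_pos _).le hMR)

end Tail

theorem theorem3 {Ω : Type*} [MeasurableSpace Ω] (P : Measure Ω) [IsProbabilityMeasure P]
    (k : ℕ) (μ : ℝ) (A L V : ℕ → Ω → ℝ) (s : ℕ → Ω → Fin k)
    (hsys : IsGMkSystem P k μ A L V s)
    (θ : ℝ) (hθ_pos : 0 < θ) (hθ_lt : θ < k * μ) (hθ_ne : θ ≠ μ) :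
    -- general arrivals
    (∀ σA ρA : ℝ → ℝ, IsLowerConstrained P A σA ρA → rhoZ k μ θ < ρA (-θ) →
      ∀ α : ℝ, α = Real.exp (θ * σA (-θ)) / (1 - Real.exp (-θ * (ρA (-θ) - rhoZ k μ θ))) →
      ∀ n : ℕ,
        (∀ τ : ℝ, 0 ≤ τ → P.real {ω | sojournTime A L V n ω > τ} ≤
          α * (μ / (μ - θ)) * (Real.exp (-θ * τ) - Real.exp (-μ * τ)) + Real.exp (-μ * τ)) ∧
        (∀ τ : ℝ, P.real {ω | waitingTime A V n ω > τ} ≤ α * Real.exp (-θ * τ))) ∧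
    -- arrivals with iid inter-arrival times, where the prefactor is one
    (HasIIDInterarrivals P A → rhoZ k μ θ ≤ giArrivalRate P A θ →
      ∀ n : ℕ,
        (∀ τ : ℝ, 0 ≤ τ → P.real {ω | sojournTime A L V n ω > τ} ≤
          μ / (μ - θ) * (Real.exp (-θ * τ) - Real.exp (-μ * τ)) + Real.exp (-μ * τ)) ∧
        (∀ τ : ℝ, P.real {ω | waitingTime A V n ω > τ} ≤ Real.exp (-θ * τ))) := by
  have : NeZero k := ⟨by rintro rfl; simp at hθ_lt; linarith⟩
  refine ⟨fun σA ρA hA hρ α hα n => ?_, fun hA hρ n => ?_⟩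
  · have hq1 : Real.exp (-θ * (ρA (-θ) - rhoZ k μ θ)) < 1 := Real.exp_lt_one_iff.2 (by nlinarith)
    refine hsys.bounds_of_waitTail_le hθ_ne ?_ n fun τ => ?_
    · rw [hα]
      exact (div_pos (Real.exp_pos _) (sub_pos.2 hq1)).le
    · rw [hα]
      exact hsys.waitTail_le_of_isLowerConstrained hθ_pos hθ_lt hA hρ n τ
  · have h := hsys.bounds_of_waitTail_le (α := 1) hθ_ne zero_le_one n fun τ => by
      rw [one_mul]
      exact hsys.waitTail_le_of_hasIIDInterarrivals hθ_pos hθ_lt hA hρ n τ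
    simpa only [one_mul] using h
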